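/- Let $\phi:\mathbb N\to\mathbb R_+$ satisfy $\phi(N)=o(\sqrt N)$ as $N\to\infty$. Let $(X_n)_{n\ge1}$ be a sequence of i.i.d. real random variables and let $(Z_n)_{n\ge1}$ be a sequence of independent random signs (with values in $\{-1,+1\}$), defined on the same probability space and such that the sequences $(X_n)_{n\ge1}$ and $(Z_n)_{n\ge1}$ are independent of each other. Put $r_n=\mathbb P(Z_n=+1)$. Assume that one of the following holds: (a) $X_1$ is almost surely equal to a nonzero constant and $$\liminf_{N\to\infty}\frac1N\sum_{k=1}^N r_k(1-r_k)>0;$$ (b) $X_1$ is not almost surely constant. Then $$\lim_{N\to\infty}\mathbb P\Big(\Big|\sum_{k=1}^N Z_kX_k\Big|>\phi(N)\Big)=1.$$ -/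

import Mathlib

open MeasureTheory ProbabilityTheory Filter Topology Asymptotics

/-!
The probability that a sum `S` lies in `[-a, a]` is controlled by its characteristic function near
the origin: since `1_{|x| ≤ a} ≤ e^{1/2} exp (-x² / (2a²))` and the Gaussian weight is itself the
characteristic function of a standard normal variable `G` at `x / a`, Fubini's theorem gives
`P(|S| ≤ a) ≤ e^{1/2} E ‖charFun S (G / a)‖`
(`measureReal_abs_le_le_integral_norm_charFun`).  If the partial sums satisfy
`‖charFun S_N t‖ ≤ exp (-c N t²)` for `|t| ≤ δ`, then, choosing `a = a_N ≥ φ N` with `a_N → ∞` and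
`a_N = o(√N)`, the integrand tends to `0` for every `G ≠ 0`, and dominated convergence yields
`P(|S_N| ≤ φ N) → 0` (`tendsto_measureReal_abs_le_of_norm_charFun_le`).

The Gaussian decay comes from the factors.  The products `Z k * X k` are independent, and with
`f = charFun X` the characteristic function of `Z k * X k` is `r f + (1 - r) conj f`, whose squared
modulus is `‖f‖² - 4 r (1 - r) (Im f)²` (`sq_norm_charFun_map_sign_mul`).  If `X` is not almost
surely constant, this is at most `‖f‖²`, and `‖f t‖ ≤ exp (-c t²)` near `0`, by symmetrisation
(`exists_norm_charFun_le_exp_neg_mul_sq`).  If `X = b ≠ 0`, it is `1 - 4 r (1 - r) sin² (t b)`, and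
the hypothesis on the averages of `r (1 - r)` makes the product over `k < N` decay as required
(`exists_norm_charFun_sum_le`).
-/

/-! ### Independence of pairs -/

open MeasurableSpace in
/-- The rectangles `{X n ∈ A} ∩ {Z n ∈ B}` form a π-system generating the σ-algebra of the pair
`(X n, Z n)`, and on these independence is an intersection of `X`-events with `Z`-events. -/
theorem iIndepFun_prodMk_of_indepFun {Ω ι α β : Type*} [MeasurableSpace Ω] [MeasurableSpace α]
    [MeasurableSpace β] {μ : Measure Ω} [IsProbabilityMeasure μ] {X : ι → Ω → α} {Z : ι → Ω → β}
    (hX_meas : ∀ n, Measurable (X n)) (hZ_meas : ∀ n, Measurable (Z n))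
    (hX : iIndepFun X μ) (hZ : iIndepFun Z μ)
    (hXZ : IndepFun (fun ω n => X n ω) (fun ω n => Z n ω) μ) :
    iIndepFun (fun n ω => (X n ω, Z n ω)) μ := by
  rw [iIndepFun_iff_iIndep]
  refine iIndepSets.iIndep (fun n => ((hX_meas n).prodMk (hZ_meas n)).comap_le)
    (fun n => {s | ∃ t ∈ Set.image2 (· ×ˢ ·) {s : Set α | MeasurableSet s}
      {t : Set β | MeasurableSet t}, (fun ω => (X n ω, Z n ω)) ⁻¹' t = s})
    (fun n => isPiSystem_prod.comap _) (fun n => ?_) ?_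
  · rw [← generateFrom_prod, comap_generateFrom]
    rfl
  · rw [iIndepSets_iff]
    intro s f hf
    have hf' : ∀ i : ι, ∃ A : Set α, ∃ B : Set β, MeasurableSet A ∧ MeasurableSet B ∧
        (i ∈ s → f i = X i ⁻¹' A ∩ Z i ⁻¹' B) := by
      intro i
      by_cases hi : i ∈ s
      · obtain ⟨_, ⟨A, hA, B, hB, rfl⟩, h⟩ := hf i hi
        exact ⟨A, B, hA, hB, fun _ => h.symm⟩
      · exact ⟨∅, ∅, .empty, .empty, fun h => absurd h hi⟩
    choose A B hA hB h using hf'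
    have hsplit : ⋂ i ∈ s, f i = ((fun ω n => X n ω) ⁻¹' ⋂ i ∈ s, {x | x i ∈ A i}) ∩
        ((fun ω n => Z n ω) ⁻¹' ⋂ i ∈ s, {z | z i ∈ B i}) := by
      ext ω
      simp only [Set.mem_iInter, Set.mem_inter_iff, Set.mem_preimage, Set.mem_ofPred_eq]
      refine ⟨fun H => ⟨fun i hi => ?_, fun i hi => ?_⟩, fun H i hi => ?_⟩
      · have := H i hi
        rw [h i hi] at this
        exact this.1
      · have := H i hi
        rw [h i hi] at this
        exact this.2
      · rw [h i hi]
        exact ⟨H.1 i hi, H.2 i hi⟩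
    have hmA : MeasurableSet (⋂ i ∈ s, {x : ι → α | x i ∈ A i}) :=
      .biInter s.countable_toSet fun i _ => measurable_pi_apply i (hA i)
    have hmB : MeasurableSet (⋂ i ∈ s, {z : ι → β | z i ∈ B i}) :=
      .biInter s.countable_toSet fun i _ => measurable_pi_apply i (hB i)
    have hprod : ∀ i ∈ s, μ (f i) = μ (X i ⁻¹' A i) * μ (Z i ⁻¹' B i) := by
      intro i hi
      rw [h i hi]
      exact (hXZ.comp (measurable_pi_apply i) (measurable_pi_apply i)).measure_inter_preimage_eq_mul
        _ _ (hA i) (hB i)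
    rw [hsplit, hXZ.measure_inter_preimage_eq_mul _ _ hmA hmB, Finset.prod_congr rfl hprod,
      Finset.prod_mul_distrib,
      ← hX.measure_inter_preimage_eq_mul s (fun i _ => hA i),
      ← hZ.measure_inter_preimage_eq_mul s (fun i _ => hB i)]
    simp only [Set.preimage_iInter]
    rfl

/-! ### Small-ball probabilities and characteristic functions -/

/-- Gaussian smoothing: a bound for the mass of `[-a, a]` by the characteristic function at scale
`1 / a`. -/
theorem measureReal_abs_le_le_integral_norm_charFun (ν : Measure ℝ) [IsProbabilityMeasure ν]
    {a : ℝ} (ha : 0 < a) :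
    ν.real {x | |x| ≤ a} ≤ Real.exp (1 / 2) * ∫ g, ‖charFun ν (g / a)‖ ∂gaussianReal 0 1 := by
  have hswap : ∫ g, charFun ν (g / a) ∂gaussianReal 0 1
      = ((∫ x, Real.exp (-(x / a) ^ 2 / 2) ∂ν : ℝ) : ℂ) := by
    calc ∫ g, charFun ν (g / a) ∂gaussianReal 0 1
        = ∫ g, ∫ x, Complex.exp (((g / a : ℝ) : ℂ) * x * Complex.I) ∂ν ∂gaussianReal 0 1 := by
          simp_rw [charFun_apply_real]
      _ = ∫ x, ∫ g, Complex.exp (((g / a : ℝ) : ℂ) * x * Complex.I) ∂gaussianReal 0 1 ∂ν := by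
          apply integral_integral_swap
          refine (integrable_const (1 : ℝ)).mono (by fun_prop) (ae_of_all _ fun p => ?_)
          simp only [Function.uncurry]
          rw [← Complex.ofReal_mul, Complex.norm_exp_ofReal_mul_I, norm_one]
      _ = ∫ x, ((Real.exp (-(x / a) ^ 2 / 2) : ℝ) : ℂ) ∂ν := by
          refine integral_congr_ae (ae_of_all _ fun x => ?_)
          have := charFun_gaussianReal (μ := 0) (v := 1) (x / a)
          rw [charFun_apply_real] at this
          simp only
          rw [Complex.ofReal_exp]
          convert this using 1
          · congr 1
            ext g
            push_cast
            ring_nf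
          · push_cast
            ring_nf
      _ = _ := integral_ofReal
  have hint : Integrable (fun x => Real.exp (-(x / a) ^ 2 / 2)) ν := by
    refine (integrable_const (1 : ℝ)).mono (by fun_prop) (ae_of_all _ fun x => ?_)
    rw [Real.norm_of_nonneg (Real.exp_nonneg _), norm_one, Real.exp_le_one_iff]
    nlinarith [sq_nonneg (x / a)]
  have hset : MeasurableSet {x : ℝ | |x| ≤ a} := measurableSet_le (by fun_prop) (by fun_prop)
  calc ν.real {x | |x| ≤ a} = ∫ x, {x : ℝ | |x| ≤ a}.indicator 1 x ∂ν :=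
        (integral_indicator_one hset).symm
    _ ≤ ∫ x, Real.exp (1 / 2) * Real.exp (-(x / a) ^ 2 / 2) ∂ν := by
        refine integral_mono ((integrable_const (1 : ℝ)).indicator hset) (hint.const_mul _)
          (Set.indicator_le' (fun x hx => ?_) fun x _ => by positivity)
        have : (x / a) ^ 2 ≤ 1 := by
          rw [sq_le_one_iff_abs_le_one, abs_div, abs_of_pos ha]
          exact (div_le_one ha).2 hx
        simp only [Pi.one_apply, ← Real.exp_add]
        exact Real.one_le_exp (by linarith)
    _ = Real.exp (1 / 2) * ‖∫ g, charFun ν (g / a) ∂gaussianReal 0 1‖ := by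
        rw [integral_const_mul, hswap, Complex.norm_real, Real.norm_of_nonneg]
        exact integral_nonneg fun x => Real.exp_nonneg _
    _ ≤ _ := by
        gcongr
        exact norm_integral_le_integral_norm _

/-- Gaussian decay, at rate `N`, of the characteristic functions on a fixed neighbourhood of `0` makes
the mass of any window of size `o(√N)` vanish. -/
theorem tendsto_measureReal_abs_le_of_norm_charFun_le {ν : ℕ → Measure ℝ}
    [∀ N, IsProbabilityMeasure (ν N)] {φ : ℕ → ℝ} (hφ_nonneg : ∀ N, 0 ≤ φ N)
    (hφ : φ =o[atTop] (fun N : ℕ => Real.sqrt (N : ℝ))) {c δ : ℝ} (hc : 0 < c) (hδ : 0 < δ)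
    (h : ∀ᶠ N in atTop, ∀ t : ℝ, |t| ≤ δ → ‖charFun (ν N) t‖ ≤ Real.exp (-(c * N * t ^ 2))) :
    Tendsto (fun N => (ν N).real {x | |x| ≤ φ N}) atTop (𝓝 0) := by
  -- The summand `N ^ (1 / 4)` forces `a N → ∞`, which brings `g / a N` into `[-δ, δ]`.
  set a : ℕ → ℝ := fun N => φ N + (N : ℝ) ^ (1 / 4 : ℝ) with ha
  have hN : Tendsto (fun N : ℕ => (N : ℝ) ^ (1 / 4 : ℝ)) atTop atTop :=
    (tendsto_rpow_atTop (by norm_num)).comp tendsto_natCast_atTop_atTop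
  have ha_top : Tendsto a atTop atTop :=
    tendsto_atTop_mono (fun N => le_add_of_nonneg_left (hφ_nonneg N)) hN
  have ha_o : a =o[atTop] (fun N : ℕ => Real.sqrt (N : ℝ)) := by
    refine hφ.add (isLittleO_of_tendsto' ?_ (hN.inv_tendsto_atTop.congr' ?_))
    · filter_upwards [eventually_gt_atTop 0] with N h1 h2
      exact absurd h2 (Real.sqrt_pos.2 (by exact_mod_cast h1)).ne'
    · filter_upwards [eventually_gt_atTop 0] with N h1
      have h2 : (0 : ℝ) < N := by exact_mod_cast h1
      rw [Pi.inv_apply, Real.sqrt_eq_rpow, ← Real.rpow_neg h2.le, ← Real.rpow_sub h2]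
      norm_num
  have hratio : Tendsto (fun N : ℕ => (N : ℝ) / a N ^ 2) atTop atTop := by
    have h0 : Tendsto (fun N : ℕ => (a N / Real.sqrt N) ^ 2) atTop (𝓝[>] 0) := by
      rw [tendsto_nhdsWithin_iff]
      refine ⟨by simpa using (ha_o.tendsto_div_nhds_zero).pow 2, ?_⟩
      filter_upwards [ha_top.eventually_gt_atTop 0, eventually_gt_atTop 0] with N h1 h2
      have : 0 < Real.sqrt N := Real.sqrt_pos.2 (by exact_mod_cast h2)
      exact Set.mem_Ioi.2 (by positivity)
    refine h0.inv_tendsto_nhdsGT_zero.congr fun N => ?_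
    simp [div_pow]
  have hlim : Tendsto (fun N => ∫ g, ‖charFun (ν N) (g / a N)‖ ∂gaussianReal 0 1) atTop (𝓝 0) := by
    have hne : ∀ᵐ g ∂gaussianReal 0 1, g ≠ 0 := by
      have := nullSingletonClass_gaussianReal (μ := 0) (v := 1) one_ne_zero
      exact Measure.ae_ne _ 0
    suffices Tendsto (fun N => ∫ g, ‖charFun (ν N) (g / a N)‖ ∂gaussianReal 0 1) atTop
        (𝓝 (∫ _, (0 : ℝ) ∂gaussianReal 0 1)) by simpa using this
    refine tendsto_integral_of_dominated_convergence (fun _ => 1)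
      (fun N => (measurable_charFun.comp (measurable_id.div_const _)).norm.aestronglyMeasurable)
      (integrable_const _) (fun N => ae_of_all _ fun g => ?_) ?_
    · rw [norm_norm]
      exact norm_charFun_le_one _
    · filter_upwards [hne] with g hg
      have hbound : Tendsto (fun N : ℕ => Real.exp (-(c * g ^ 2 * (N / a N ^ 2)))) atTop (𝓝 0) :=
        Real.tendsto_exp_neg_atTop_nhds_zero.comp (hratio.const_mul_atTop (by positivity))
      refine tendsto_of_tendsto_of_tendsto_of_le_of_le' tendsto_const_nhds hbound
        (Eventually.of_forall fun N => norm_nonneg _) ?_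
      filter_upwards [h, ha_top.eventually_gt_atTop 0, ha_top.eventually_ge_atTop (|g| / δ)]
        with N h1 h2 h3
      refine (h1 (g / a N) ?_).trans_eq (by ring_nf)
      rw [abs_div, abs_of_pos h2, div_le_iff₀ h2]
      rwa [div_le_iff₀ hδ, mul_comm] at h3
  refine tendsto_of_tendsto_of_tendsto_of_le_of_le' tendsto_const_nhds
    ((hlim.const_mul (Real.exp (1 / 2))).trans (by rw [mul_zero]))
    (Eventually.of_forall fun N => measureReal_nonneg) ?_
  filter_upwards [ha_top.eventually_gt_atTop 0] with N h1
  refine le_trans (measureReal_mono (s₂ := {x | |x| ≤ a N}) fun x hx => ?_)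
    (measureReal_abs_le_le_integral_norm_charFun (ν N) h1)
  rw [Set.mem_ofPred_eq] at hx ⊢
  exact hx.trans (le_add_of_nonneg_right (by positivity))

/-! ### Characteristic functions of the summands -/

/-- Symmetrisation: `‖charFun ν‖²` is the characteristic function of the difference of two
independent variables of law `ν`. -/
theorem sq_norm_charFun_eq_integral_cos (ν : Measure ℝ) [IsProbabilityMeasure ν] (t : ℝ) :
    ‖charFun ν t‖ ^ 2 = ∫ p, Real.cos (t * (p.1 - p.2)) ∂ν.prod ν := by
  have hmul : charFun ν t * charFun ν (-t)
      = ∫ p : ℝ × ℝ, Complex.exp ((t * (p.1 - p.2) : ℝ) * Complex.I) ∂ν.prod ν := by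
    rw [charFun_apply_real, charFun_apply_real, ← integral_prod_mul]
    congr 1
    ext p
    rw [← Complex.exp_add]
    push_cast
    ring_nf
  have hint : Integrable (fun p : ℝ × ℝ => Complex.exp ((t * (p.1 - p.2) : ℝ) * Complex.I))
      (ν.prod ν) := by
    refine (integrable_const (1 : ℝ)).mono (by fun_prop) (ae_of_all _ fun p => ?_)
    rw [Complex.norm_exp_ofReal_mul_I, norm_one]
  have hre := congrArg Complex.re hmul
  rw [charFun_neg, Complex.mul_conj, Complex.ofReal_re, Complex.normSq_eq_norm_sq] at hre
  rw [hre]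
  refine (integral_re hint).symm.trans ?_
  congr 1
  ext p
  exact Complex.exp_ofReal_mul_I_re _

/-- A nondegenerate law has a characteristic function with Gaussian decay near `0`, without any moment
assumption: only the part of the symmetrised variable with absolute value in a compact subset of
`(0, ∞)` is used. -/
theorem exists_norm_charFun_le_exp_neg_mul_sq (ν : Measure ℝ) [IsProbabilityMeasure ν]
    (hν : ¬ ∃ c : ℝ, ∀ᵐ x ∂ν, x = c) :
    ∃ c > 0, ∃ δ > 0, ∀ t : ℝ, |t| ≤ δ → ‖charFun ν t‖ ≤ Real.exp (-(c * t ^ 2)) := by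
  set E : ℕ → Set (ℝ × ℝ) :=
    fun n => {p | 1 / ((n : ℝ) + 1) ≤ |p.1 - p.2|} ∩ {p | |p.1 - p.2| ≤ n + 1} with hE
  have hpos : ∃ n, (ν.prod ν) (E n) ≠ 0 := by
    by_contra! hzero
    have hdiag : ∀ᵐ p ∂ν.prod ν, p.2 = p.1 := by
      refine measure_mono_null (fun p hp => ?_) (measure_iUnion_null hzero)
      have hp' : 0 < |p.1 - p.2| := abs_pos.2 (sub_ne_zero.2 (Ne.symm hp))
      obtain ⟨m, hm⟩ := exists_nat_one_div_lt hp'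
      obtain ⟨k, hk⟩ := exists_nat_ge |p.1 - p.2|
      refine Set.mem_iUnion.2 ⟨max m k, le_trans ?_ hm.le, hk.trans ?_⟩
      · gcongr
        exact le_max_left m k
      · have : (k : ℝ) ≤ (max m k : ℕ) := by exact_mod_cast le_max_right m k
        linarith
    obtain ⟨c, hc⟩ := (Measure.ae_ae_of_ae_prod hdiag).exists
    exact hν ⟨c, hc⟩
  obtain ⟨n, hn⟩ := hpos
  have hE_meas : MeasurableSet (E n) :=
    (measurableSet_le (by fun_prop) (by fun_prop)).inter
      (measurableSet_le (by fun_prop) (by fun_prop))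
  set p : ℝ := (ν.prod ν).real (E n) with hp
  have hp_pos : 0 < p := ENNReal.toReal_pos hn (measure_ne_top _ _)
  set K : ℝ := 2 / Real.pi ^ 2 * (1 / ((n : ℝ) + 1)) ^ 2 with hK
  have hK_pos : 0 < K := by positivity
  -- The bound on `|t|` keeps `t * (x - y)` in `[-π, π]` on `E n`, where the quadratic upper bound
  -- for the cosine holds.
  refine ⟨K * p / 2, by positivity, Real.pi / (n + 1), by positivity, fun t ht => ?_⟩
  rw [le_div_iff₀ (by positivity)] at ht
  have hsq : ‖charFun ν t‖ ^ 2 ≤ 1 - K * t ^ 2 * p := by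
    rw [sq_norm_charFun_eq_integral_cos]
    calc ∫ q, Real.cos (t * (q.1 - q.2)) ∂ν.prod ν
        ≤ ∫ q, (1 - (E n).indicator (fun _ => K * t ^ 2) q) ∂ν.prod ν := by
          refine integral_mono ?_ ((integrable_const _).sub
            ((integrable_const _).indicator hE_meas)) fun q => ?_
          · refine (integrable_const (1 : ℝ)).mono (by fun_prop) (ae_of_all _ fun q => ?_)
            simpa using Real.abs_cos_le_one _
          · by_cases hq : q ∈ E n
            · simp only [Set.indicator_of_mem hq]
              have h1 : |t * (q.1 - q.2)| ≤ Real.pi := by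
                rw [abs_mul]
                exact (mul_le_mul_of_nonneg_left hq.2 (abs_nonneg t)).trans ht
              have h2 : (1 / ((n : ℝ) + 1)) ^ 2 ≤ (q.1 - q.2) ^ 2 := by
                rw [← sq_abs (q.1 - q.2)]
                exact pow_le_pow_left₀ (by positivity) hq.1 2
              have h3 : K * t ^ 2 ≤ 2 / Real.pi ^ 2 * (t * (q.1 - q.2)) ^ 2 := by
                rw [hK, mul_pow, mul_assoc, mul_comm (t ^ 2)]
                gcongr
              linarith [Real.cos_le_one_sub_mul_cos_sq h1]
            · simpa [Set.indicator_of_notMem hq] using Real.cos_le_one _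
      _ = 1 - K * t ^ 2 * p := by
          rw [integral_sub (integrable_const _) ((integrable_const _).indicator hE_meas),
            integral_indicator_const _ hE_meas]
          simp [hp, mul_comm]
  refine le_of_sq_le_sq ?_ (Real.exp_nonneg _)
  rw [← Real.exp_nat_mul]
  refine hsq.trans ((Real.one_sub_le_exp_neg _).trans_eq ?_)
  push_cast
  ring_nf

/-- The characteristic function of `Z * X` is the mixture `r f + (1 - r) conj f` of that of `X` and
its conjugate, where `r = P(Z = 1)`; this is its squared modulus. -/
theorem sq_norm_charFun_map_sign_mul {Ω : Type*} [MeasurableSpace Ω] {μ : Measure Ω}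
    [IsProbabilityMeasure μ] {X Z : Ω → ℝ} (hX : Measurable X) (hZ : Measurable Z)
    (hXZ : IndepFun X Z μ) (hZ_sign : ∀ᵐ ω ∂μ, Z ω = 1 ∨ Z ω = -1) (t : ℝ) :
    ‖charFun (μ.map fun ω => Z ω * X ω) t‖ ^ 2 = ‖charFun (μ.map X) t‖ ^ 2
      - 4 * (μ.real {ω | Z ω = 1} * (1 - μ.real {ω | Z ω = 1}))
        * (charFun (μ.map X) t).im ^ 2 := by
  set r := μ.real {ω | Z ω = 1} with hr
  set f := charFun (μ.map X) t with hf
  have hset : MeasurableSet {z : ℝ | z = 1} := measurableSet_eq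
  set P : ℝ → ℂ := {z : ℝ | z = 1}.indicator 1 with hP
  have hP_meas : Measurable P := measurable_one.indicator hset
  have hP_int : ∫ ω, P (Z ω) ∂μ = r := by
    have : (fun ω => P (Z ω)) = (Z ⁻¹' {z | z = 1}).indicator fun _ => 1 := rfl
    rw [this, integral_indicator_const _ (hZ hset)]
    simp [hr, Set.preimage]
  have hP_norm : ∀ z, ‖P z‖ ≤ 1 := fun z => by
    refine (norm_indicator_le_norm_self _ _).trans ?_
    simp
  have hPi : Integrable (fun ω => P (Z ω)) μ :=
    (integrable_const (1 : ℝ)).mono (hP_meas.comp hZ).aestronglyMeasurable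
      (ae_of_all _ fun ω => by simpa using hP_norm _)
  have hexp (s : ℝ) : ∫ ω, Complex.exp (s * X ω * Complex.I) ∂μ = charFun (μ.map X) s := by
    rw [charFun_apply_real, integral_map hX.aemeasurable (by fun_prop)]
  have hnorm (s x : ℝ) : ‖Complex.exp (s * x * Complex.I)‖ = 1 := by
    rw [← Complex.ofReal_mul, Complex.norm_exp_ofReal_mul_I]
  have hmul {Q : ℝ → ℂ} (hQ : Measurable Q) (s : ℝ) :
      ∫ ω, Complex.exp (s * X ω * Complex.I) * Q (Z ω) ∂μ
        = charFun (μ.map X) s * ∫ ω, Q (Z ω) ∂μ := by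
    have := (hXZ.comp (φ := fun x : ℝ => Complex.exp (s * x * Complex.I)) (ψ := Q)
      (by fun_prop) hQ).integral_fun_mul_eq_mul_integral (by fun_prop)
        (hQ.comp hZ).aestronglyMeasurable
    simp only [Function.comp_apply] at this
    rw [this, ← hexp]
  have hint {Q : ℝ → ℂ} (hQ : Measurable Q) (hQ1 : ∀ z, ‖Q z‖ ≤ 2) (s : ℝ) :
      Integrable (fun ω => Complex.exp (s * X ω * Complex.I) * Q (Z ω)) μ := by
    refine (integrable_const (2 : ℝ)).mono
      (AEStronglyMeasurable.mul (by fun_prop) (hQ.comp hZ).aestronglyMeasurable)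
      (ae_of_all _ fun ω => ?_)
    rw [norm_mul, hnorm, one_mul]
    simpa using hQ1 _
  have hQ_meas : Measurable fun z => 1 - P z := measurable_const.sub hP_meas
  -- Almost surely `exp (i t Z X)` is `exp (i t X)` on `{Z = 1}` and `exp (-i t X)` elsewhere.
  have hmix : charFun (μ.map fun ω => Z ω * X ω) t
      = f * r + (starRingEnd ℂ) f * (1 - r) := by
    calc charFun (μ.map fun ω => Z ω * X ω) t
        = ∫ ω, Complex.exp (t * (Z ω * X ω : ℝ) * Complex.I) ∂μ := by
          rw [charFun_apply_real, integral_map (by fun_prop) (by fun_prop)]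
      _ = ∫ ω, (Complex.exp (t * X ω * Complex.I) * P (Z ω)
            + Complex.exp ((-t : ℝ) * X ω * Complex.I) * (1 - P (Z ω))) ∂μ := by
          refine integral_congr_ae ?_
          filter_upwards [hZ_sign] with ω hω
          rcases hω with h | h
          · simp [hP, h]
          · have : P (-1) = 0 := Set.indicator_of_notMem (by norm_num) _
            simp [h, this]
      _ = _ := by
          rw [integral_add (hint hP_meas (fun z => (hP_norm z).trans one_le_two) t)
              (hint hQ_meas (fun z => (norm_sub_le _ _).trans
                (by simpa using (add_le_add_right (hP_norm z) 1).trans (by norm_num))) (-t)),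
            hmul hP_meas, hmul hQ_meas, integral_sub (integrable_const _) hPi, hP_int, charFun_neg]
          simp [hf]
  rw [hmix, ← Complex.normSq_eq_norm_sq, ← Complex.normSq_eq_norm_sq, Complex.normSq_apply,
    Complex.normSq_apply]
  simp
  ring

/-! ### Sums of randomly signed variables -/

/-- Under either alternative on the law of `X 0`, the characteristic function of the `N`-th partial sum
has Gaussian decay at rate `N` near `0`. -/
theorem exists_norm_charFun_sum_le {Ω : Type*} [MeasurableSpace Ω] (μ : Measure Ω)
    [IsProbabilityMeasure μ] (X Z : ℕ → Ω → ℝ)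
    (hX_meas : ∀ n, Measurable (X n)) (hZ_meas : ∀ n, Measurable (Z n))
    (hX_indep : iIndepFun X μ) (hX_ident : ∀ n, IdentDistrib (X n) (X 0) μ μ)
    (hZ_indep : iIndepFun Z μ) (hZ_sign : ∀ n, ∀ᵐ ω ∂μ, Z n ω = 1 ∨ Z n ω = -1)
    (hXZ : IndepFun (fun ω n => X n ω) (fun ω n => Z n ω) μ)
    (hab : ((∃ c : ℝ, c ≠ 0 ∧ ∀ᵐ ω ∂μ, X 0 ω = c) ∧
          0 < liminf (fun N : ℕ => (1 / (N : ℝ)) * ∑ k ∈ Finset.range N,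
            μ.real {ω | Z k ω = 1} * (1 - μ.real {ω | Z k ω = 1})) atTop) ∨
        ¬ ∃ c : ℝ, ∀ᵐ ω ∂μ, X 0 ω = c) :
    ∃ c > 0, ∃ δ > 0, ∀ᶠ N : ℕ in atTop, ∀ t : ℝ, |t| ≤ δ →
      ‖charFun (μ.map fun ω => ∑ k ∈ Finset.range N, Z k ω * X k ω) t‖
        ≤ Real.exp (-(c * N * t ^ 2)) := by
  have hY_indep : iIndepFun (fun n ω => Z n ω * X n ω) μ :=
    (iIndepFun_prodMk_of_indepFun hX_meas hZ_meas hX_indep hZ_indep hXZ).comp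
      (fun _ p => p.2 * p.1) fun _ => by fun_prop
  have hY_meas (n : ℕ) : Measurable fun ω => Z n ω * X n ω := (hZ_meas n).mul (hX_meas n)
  have hprod (N : ℕ) (t : ℝ) :
      ‖charFun (μ.map fun ω => ∑ k ∈ Finset.range N, Z k ω * X k ω) t‖
        = ∏ k ∈ Finset.range N, ‖charFun (μ.map fun ω => Z k ω * X k ω) t‖ := by
    rw [iIndepFun.charFun_map_fun_finsetSum_eq_prod (fun k _ => (hY_meas k).aemeasurable)
      (hY_indep.restrict _), Finset.prod_apply, norm_prod]
  have hfactor (k : ℕ) (t : ℝ) : ‖charFun (μ.map fun ω => Z k ω * X k ω) t‖ ^ 2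
      = ‖charFun (μ.map (X 0)) t‖ ^ 2
        - 4 * (μ.real {ω | Z k ω = 1} * (1 - μ.real {ω | Z k ω = 1}))
          * (charFun (μ.map (X 0)) t).im ^ 2 := by
    rw [sq_norm_charFun_map_sign_mul (hX_meas k) (hZ_meas k)
      (hXZ.comp (measurable_pi_apply k) (measurable_pi_apply k)) (hZ_sign k) t,
      (hX_ident k).map_eq]
  have hr_nonneg (k : ℕ) : 0 ≤ μ.real {ω | Z k ω = 1} * (1 - μ.real {ω | Z k ω = 1}) :=
    mul_nonneg measureReal_nonneg (sub_nonneg.2 measureReal_le_one)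
  have hX0 : IsProbabilityMeasure (μ.map (X 0)) :=
    Measure.isProbabilityMeasure_map (hX_meas 0).aemeasurable
  rcases hab with ⟨⟨b, hb, hXb⟩, hlim⟩ | hconst
  · have hmap : charFun (μ.map (X 0)) = fun t => Complex.exp ((t * b : ℝ) * Complex.I) := by
      ext t
      rw [Measure.map_congr hXb, Measure.map_const, measure_univ, one_smul, charFun_dirac]
      simp
    obtain ⟨κ, hκ, hκ_lt⟩ := exists_between hlim
    have hev := eventually_lt_of_lt_liminf hκ_lt ⟨0, eventually_map.2 <| .of_forall fun N =>
      mul_nonneg (by positivity) (Finset.sum_nonneg fun k _ => hr_nonneg k)⟩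
    -- The radius `π / (2 |b|)` is where `|sin (t b)| ≥ (2 / π) |t b|` is available.
    refine ⟨2 * κ * (2 / Real.pi * |b|) ^ 2, by positivity, Real.pi / 2 / |b|, by positivity, ?_⟩
    filter_upwards [hev, eventually_gt_atTop 0] with N hN hN0 t ht
    rw [le_div_iff₀ (abs_pos.2 hb), ← abs_mul] at ht
    have hsin : (2 / Real.pi * |b|) ^ 2 * t ^ 2 ≤ Real.sin (t * b) ^ 2 := by
      have := pow_le_pow_left₀ (by positivity) (Real.mul_abs_le_abs_sin ht) 2
      rw [sq_abs] at this
      refine le_of_eq_of_le ?_ this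
      rw [abs_mul, ← sq_abs t]
      ring
    have hterm (k : ℕ) : ‖charFun (μ.map fun ω => Z k ω * X k ω) t‖
        ≤ Real.exp (-(2 * Real.sin (t * b) ^ 2
          * (μ.real {ω | Z k ω = 1} * (1 - μ.real {ω | Z k ω = 1})))) := by
      refine le_of_sq_le_sq ?_ (Real.exp_nonneg _)
      rw [hfactor, hmap, Complex.norm_exp_ofReal_mul_I, Complex.exp_ofReal_mul_I_im,
        ← Real.exp_nat_mul, one_pow]
      refine (Real.one_sub_le_exp_neg _).trans_eq ?_
      push_cast
      ring_nf
    rw [hprod]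
    refine (Finset.prod_le_prod (fun _ _ => norm_nonneg _) fun k _ => hterm k).trans ?_
    rw [← Real.exp_sum, Real.exp_le_exp, Finset.sum_neg_distrib, ← Finset.mul_sum, neg_le_neg_iff]
    have hN' : κ * N ≤ ∑ k ∈ Finset.range N,
        μ.real {ω | Z k ω = 1} * (1 - μ.real {ω | Z k ω = 1}) := by
      have h0 : (0 : ℝ) < N := by exact_mod_cast hN0
      rw [one_div_mul_eq_div, lt_div_iff₀ h0] at hN
      exact hN.le
    calc 2 * κ * (2 / Real.pi * |b|) ^ 2 * N * t ^ 2
        = 2 * ((2 / Real.pi * |b|) ^ 2 * t ^ 2) * (κ * N) := by ring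
      _ ≤ _ := by gcongr
  · obtain ⟨c, hc, δ, hδ, h⟩ := exists_norm_charFun_le_exp_neg_mul_sq (μ.map (X 0)) (by
      rintro ⟨c, hc⟩
      exact hconst ⟨c, ae_of_ae_map (hX_meas 0).aemeasurable hc⟩)
    refine ⟨c, hc, δ, hδ, .of_forall fun N t ht => ?_⟩
    have hterm (k : ℕ) : ‖charFun (μ.map fun ω => Z k ω * X k ω) t‖
        ≤ Real.exp (-(c * t ^ 2)) := by
      refine le_trans (le_of_sq_le_sq ?_ (norm_nonneg _)) (h t ht)
      rw [hfactor]
      have := mul_nonneg (hr_nonneg k) (sq_nonneg (charFun (μ.map (X 0)) t).im)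
      linarith
    rw [hprod]
    refine (Finset.prod_le_prod (fun _ _ => norm_nonneg _) fun k _ => hterm k).trans_eq ?_
    rw [Finset.prod_const, Finset.card_range, ← Real.exp_nat_mul]
    ring_nf

/-- The sequences are indexed from `0`, so that `X k`, `Z k`, `r k` stand for the `(k+1)`-st
terms and a sum over `Finset.range N` is the sum of the first `N` terms. -/
theorem lemma1 {Ω : Type*} [MeasurableSpace Ω] (μ : Measure Ω) [IsProbabilityMeasure μ]
    (φ : ℕ → ℝ) (hφ_nonneg : ∀ N, 0 ≤ φ N)
    (hφ : φ =o[atTop] (fun N : ℕ => Real.sqrt (N : ℝ)))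
    (X Z : ℕ → Ω → ℝ) (r : ℕ → ℝ)
    (hX_meas : ∀ n, Measurable (X n)) (hZ_meas : ∀ n, Measurable (Z n))
    (hX_indep : iIndepFun X μ) (hX_ident : ∀ n, IdentDistrib (X n) (X 0) μ μ)
    (hZ_indep : iIndepFun Z μ) (hZ_sign : ∀ n, ∀ᵐ ω ∂μ, Z n ω = 1 ∨ Z n ω = -1)
    (hXZ : IndepFun (fun ω n => X n ω) (fun ω n => Z n ω) μ)
    (hr : ∀ n, r n = μ.real {ω | Z n ω = 1})
    (hab : ((∃ c : ℝ, c ≠ 0 ∧ ∀ᵐ ω ∂μ, X 0 ω = c) ∧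
          0 < liminf (fun N : ℕ => (1 / (N : ℝ)) * ∑ k ∈ Finset.range N, r k * (1 - r k)) atTop) ∨
        ¬ ∃ c : ℝ, ∀ᵐ ω ∂μ, X 0 ω = c) :
    Tendsto (fun N : ℕ => μ.real {ω | φ N < |∑ k ∈ Finset.range N, Z k ω * X k ω|})
      atTop (𝓝 1) := by
  obtain rfl : r = fun n => μ.real {ω | Z n ω = 1} := funext hr
  obtain ⟨c, hc, δ, hδ, h⟩ := exists_norm_charFun_sum_le μ X Z hX_meas hZ_meas hX_indep hX_ident
    hZ_indep hZ_sign hXZ hab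
  have hS_meas (N : ℕ) : Measurable fun ω => ∑ k ∈ Finset.range N, Z k ω * X k ω :=
    Finset.measurable_fun_sum _ fun k _ => (hZ_meas k).mul (hX_meas k)
  have (N : ℕ) : IsProbabilityMeasure (μ.map fun ω => ∑ k ∈ Finset.range N, Z k ω * X k ω) :=
    Measure.isProbabilityMeasure_map (hS_meas N).aemeasurable
  have hlim := (tendsto_measureReal_abs_le_of_norm_charFun_le hφ_nonneg hφ hc hδ h).const_sub 1
  rw [sub_zero] at hlim
  refine hlim.congr fun N => ?_
  have hset : MeasurableSet {x : ℝ | |x| ≤ φ N} := measurableSet_le (by fun_prop) (by fun_prop)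
  rw [map_measureReal_apply (hS_meas N) hset, ← probReal_compl_eq_one_sub (hS_meas N hset)]
  congr 1
  ext ω
  simp
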